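/- **Corollary (strong convexity via subgradient graphical derivatives).** Let $\Omega\subset\mathbb R^n$ be a nonempty open convex set, and let $\varphi:\Omega\to(-\infty,\infty]$ be proper (finite at some point) and lower semicontinuous. Suppose that one of the following holds: (i) $\varphi$ is (finite and) differentiable on $\Omega$, and $\nabla\varphi$ is Lipschitz continuous on $\Omega$; (ii) $\Omega=\mathbb R^n$, and $\varphi$ is weakly convex. Let $\kappa>0$. Then $\varphi$ is strongly convex on $\Omega$ with modulus $\kappa$ if and only if $$\langle z,w\rangle\ \ge\ \kappa\|w\|^2\quad\text{for all } x\in\Omega,\ (x,y)\in\operatorname{gph}\partial\varphi,\ w\in\mathbb R^n,\ z\in\partial^2_D\varphi(x,y)(w).$$ Here $\mathbb R^n$ carries the Euclidean norm and inner product, and the following definitions are used. * For $s\in\mathbb R$, $\varphi$ is $s$-convex on $\Omega$ if $\varphi((1-\lambda)x+\lambda y)\le(1-\lambda)\varphi(x)+\lambda\varphi(y)-\frac s2\lambda(1-\lambda)\|x-y\|^2$ for all $x,y\in\Omega$ and $\lambda\in(0,1)$. It is strongly convex with modulus $\kappa>0$ if it is $\kappa$-convex, and weakly convex if it is $(-\rho)$-convex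 for some $\rho>0$. * For $S\subset\mathbb R^m$ and $\bar z\in S$, the regular normal cone is $\widehat N_S(\bar z)=\{v:\limsup_{z\to\bar z,\ z\in S\setminus\{\bar z\}}\langle v,z-\bar z\rangle/\|z-\bar z\|\le 0\}$ (with the upper limit read as $-\infty$ if $\bar z$ is isolated in $S$). The limiting normal cone $N_S(\bar z)$ consists of all limits of sequences $v_k\in\widehat N_S(z_k)$ with $z_k\in S$, $z_k\to\bar z$. The tangent cone $T_S(\bar z)$ consists of all $w$ for which there are $t_k>0$, $t_k\to0$ and $w_k\to w$ with $\bar z+t_kw_k\in S$ for all $k$. * The limiting subdifferential at $x\in\Omega$ with $\varphi(x)<\infty$ is $\partial\varphi(x)=\{v:(v,-1)\in N_{\operatorname{epi}\varphi}(x,\varphi(x))\}$, where $\operatorname{epi}\varphi=\{(x,\alpha)\in\Omega\times\mathbb R:\alpha\ge\varphi(x)\}$; $\partial\varphi(x)=\emptyset$ for all other $x$. Its graph is $\operatorname{gph}\partial\varphi=\{(x,y):y\in\partial\varphi(x)\}$. * The subgradient graphical derivative at $(x,y)\in\operatorname{gph}\partial\varphi$ is $\partial^2_D\varphi(x,y)(w)=\{z:(w,z)\in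 T_{\operatorname{gph}\partial\varphi}(x,y)\}$. -/

import Mathlib

open Filter Topology Set

noncomputable section

namespace VarAnalysis

/-- The Bouligand-Severi tangent (contingent) cone to `S` at `z`: all limits `w` of sequences `w k`
such that `z + t k • w k ∈ S` for some positive reals `t k` tending to `0`. -/
def contingentCone {X : Type*} [NormedAddCommGroup X] [NormedSpace ℝ X]
    (S : Set X) (z : X) : Set X :=
  {w | ∃ (t : ℕ → ℝ) (u : ℕ → X), (∀ k, 0 < t k) ∧ Tendsto t atTop (𝓝 0) ∧
    Tendsto u atTop (𝓝 w) ∧ ∀ k, z + t k • u k ∈ S}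

/-- The (Fréchet) regular normal cone to `S` at `z`, empty for `z ∉ S`. The upper limit is taken
over `x → z` with `x ∈ S`, `x ≠ z`, in the extended reals. -/
def regularNormalCone {X : Type*} [NormedAddCommGroup X] [InnerProductSpace ℝ X]
    (S : Set X) (z : X) : Set X :=
  {v | z ∈ S ∧
    limsup (fun x => ((inner ℝ v (x - z) / ‖x - z‖ : ℝ) : EReal)) (𝓝[S \ {z}] z) ≤ 0}

/-- Membership in the regular normal cone in terms of `ε`. -/
theorem mem_regularNormalCone_iff {X : Type*} [NormedAddCommGroup X] [InnerProductSpace ℝ X]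
    (S : Set X) (z v : X) :
    v ∈ regularNormalCone S z ↔
      z ∈ S ∧ ∀ ε : ℝ, 0 < ε → ∀ᶠ x in 𝓝[S] z, inner ℝ v (x - z) ≤ ε * ‖x - z‖ := by
  unfold regularNormalCone
  refine and_congr_right fun _ => ?_
  rw [Filter.limsup_le_iff]
  constructor
  · intro h ε hε
    have h1 := h (ε : EReal) (by exact_mod_cast hε)
    rw [eventually_nhdsWithin_iff] at h1 ⊢
    filter_upwards [h1] with x hx hxS
    by_cases hxz : x = z
    · simp [hxz]
    · have h2 : inner ℝ v (x - z) / ‖x - z‖ < ε := by exact_mod_cast hx ⟨hxS, hxz⟩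
      rw [div_lt_iff₀ (norm_pos_iff.2 (sub_ne_zero.2 hxz))] at h2
      exact h2.le
  · intro h y hy
    obtain ⟨ε, hε, hεy⟩ := EReal.lt_iff_exists_real_btwn.1 hy
    have h1 := h ε (by exact_mod_cast hε)
    rw [eventually_nhdsWithin_iff] at h1 ⊢
    filter_upwards [h1] with x hx hxS
    refine lt_of_le_of_lt ?_ hεy
    have hxz : x ≠ z := hxS.2
    have h2 : inner ℝ v (x - z) / ‖x - z‖ ≤ ε :=
      (div_le_iff₀ (norm_pos_iff.2 (sub_ne_zero.2 hxz))).2 (hx hxS.1)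
    exact_mod_cast h2

/-- The (Mordukhovich) limiting normal cone to `S` at `z`, empty for `z ∉ S`. -/
def limitingNormalCone {X : Type*} [NormedAddCommGroup X] [InnerProductSpace ℝ X]
    (S : Set X) (z : X) : Set X :=
  {v | z ∈ S ∧ ∃ (x : ℕ → X) (u : ℕ → X), (∀ k, x k ∈ S) ∧ Tendsto x atTop (𝓝 z) ∧
    Tendsto u atTop (𝓝 v) ∧ ∀ k, u k ∈ regularNormalCone S (x k)}

/-! An extended-real-valued function on a set `Ω ⊆ ℝⁿ` is represented by `Ω` together with a
function `φ : ℝⁿ → EReal`; every notion below uses the values of `φ` on `Ω` only. -/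

/-- `φ : Ω → (-∞, ∞]` is proper: it never takes the value `-∞`, and is finite somewhere. -/
def IsProper {n : ℕ} (Ω : Set (EuclideanSpace ℝ (Fin n)))
    (φ : EuclideanSpace ℝ (Fin n) → EReal) : Prop :=
  (∀ x ∈ Ω, φ x ≠ ⊥) ∧ ∃ x ∈ Ω, φ x < ⊤

/-- The epigraph of `φ : Ω → (-∞, ∞]`, as a subset of the Euclidean space `ℝⁿ × ℝ`
(with the `ℓ²` product structure). -/
def epi {n : ℕ} (Ω : Set (EuclideanSpace ℝ (Fin n)))
    (φ : EuclideanSpace ℝ (Fin n) → EReal) :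
    Set (WithLp 2 (EuclideanSpace ℝ (Fin n) × ℝ)) :=
  {p | p.fst ∈ Ω ∧ φ p.fst ≤ (p.snd : EReal)}

/-- The basic (limiting) subdifferential of `φ : Ω → (-∞, ∞]` at `x`; it is empty unless `x ∈ Ω`
and `φ x < ∞`. -/
def limitingSubdifferential {n : ℕ} (Ω : Set (EuclideanSpace ℝ (Fin n)))
    (φ : EuclideanSpace ℝ (Fin n) → EReal) (x : EuclideanSpace ℝ (Fin n)) :
    Set (EuclideanSpace ℝ (Fin n)) :=
  {v | x ∈ Ω ∧ φ x < ⊤ ∧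
    WithLp.toLp 2 (v, (-1 : ℝ)) ∈
      limitingNormalCone (epi Ω φ) (WithLp.toLp 2 (x, (φ x).toReal))}

/-- The graph of a set-valued mapping. -/
def gph {X Y : Type*} (F : X → Set Y) : Set (X × Y) :=
  {p | p.2 ∈ F p.1}

/-- The graphical derivative `DF(x, y)(w)` of a set-valued mapping `F`, empty if
`(x, y) ∉ gph F`. -/
def graphicalDerivative {X Y : Type*} [NormedAddCommGroup X] [NormedSpace ℝ X]
    [NormedAddCommGroup Y] [NormedSpace ℝ Y] (F : X → Set Y) (x : X) (y : Y) (w : X) : Set Y :=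
  {z | (x, y) ∈ gph F ∧ (w, z) ∈ contingentCone (gph F) (x, y)}

/-- The subgradient graphical derivative `∂²_D φ(x, y)(w) = (D ∂φ)(x, y)(w)`. -/
def subgradientGraphicalDerivative {n : ℕ} (Ω : Set (EuclideanSpace ℝ (Fin n)))
    (φ : EuclideanSpace ℝ (Fin n) → EReal) (x y w : EuclideanSpace ℝ (Fin n)) :
    Set (EuclideanSpace ℝ (Fin n)) :=
  graphicalDerivative (limitingSubdifferential Ω φ) x y w

/-- `φ` is `s`-convex on `Ω`. -/
def IsSConvexOn {n : ℕ} (s : ℝ) (Ω : Set (EuclideanSpace ℝ (Fin n)))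
    (φ : EuclideanSpace ℝ (Fin n) → EReal) : Prop :=
  ∀ x ∈ Ω, ∀ y ∈ Ω, ∀ t : ℝ, 0 < t → t < 1 →
    φ ((1 - t) • x + t • y) ≤
      ((1 - t : ℝ) : EReal) * φ x + (t : EReal) * φ y
        - ((s / 2 * t * (1 - t) * ‖x - y‖ ^ 2 : ℝ) : EReal)

/-- `φ` is strongly convex on `Ω` with modulus `κ > 0`. -/
def IsStronglyConvexOn {n : ℕ} (κ : ℝ) (Ω : Set (EuclideanSpace ℝ (Fin n)))
    (φ : EuclideanSpace ℝ (Fin n) → EReal) : Prop :=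
  0 < κ ∧ IsSConvexOn κ Ω φ

/-- `φ` is weakly convex on `Ω`: it is `(-ρ)`-convex for some `ρ > 0`. -/
def IsWeaklyConvexOn {n : ℕ} (Ω : Set (EuclideanSpace ℝ (Fin n)))
    (φ : EuclideanSpace ℝ (Fin n) → EReal) : Prop :=
  ∃ ρ : ℝ, 0 < ρ ∧ IsSConvexOn (-ρ) Ω φ

/-- On the open set `Ω`, `φ` is finite and differentiable, with Lipschitz continuous gradient. -/
def IsDifferentiableWithLipschitzGradientOn {n : ℕ} (Ω : Set (EuclideanSpace ℝ (Fin n)))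
    (φ : EuclideanSpace ℝ (Fin n) → EReal) : Prop :=
  (∀ x ∈ Ω, φ x ≠ ⊥ ∧ φ x ≠ ⊤) ∧
    DifferentiableOn ℝ (fun x => (φ x).toReal) Ω ∧
    ∃ L : NNReal, LipschitzOnWith L (gradient fun x => (φ x).toReal) Ω

end VarAnalysis

end

/-! If `φ` is κ-convex, adding two subgradient inequalities makes `∂φ` strongly monotone with
constant κ; dividing by the squared step and passing to the limit gives the bound on the graphical
derivative.

For the converse, take a Lipschitz gradient `g` of a function. By
`strongly_monotone_of_clusterPt_quotient` and `sconvex_of_strongly_monotone_gradient`, a lower bound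
on the limits of its directional quotients integrates to strong convexity. In case (i) this applies
to `φ` itself, since such limits belong to the graphical derivative.

In case (ii) it applies to the Moreau envelopes with parameter `μ > ρ`, whose gradient `μ • (u - P
u)` is Lipschitz and lies in `∂φ (P u)`. The bound κ becomes `κ * μ / (μ + κ)`. As `μ → ∞` this
modulus tends to κ and the proximal points converge, so lower semicontinuity transfers the
inequality to `φ`. -/

namespace VarAnalysis

/-! ### Integrating first-order bounds along segments. -/

section StrongMonotonicity

variable {E : Type*} [NormedAddCommGroup E] [InnerProductSpace ℝ E]


/-- A Lipschitz vector field on a convex set whose directional difference quotients have only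
cluster points `d` with `c * ‖h‖ ^ 2 ≤ ⟪d, h⟫` is strongly monotone. -/
theorem strongly_monotone_of_clusterPt_quotient [ProperSpace E] {Ω : Set E} (hΩ : Convex ℝ Ω)
    {g : E → E} {L : NNReal} (hg : LipschitzOnWith L g Ω) {c : ℝ}
    (H : ∀ x ∈ Ω, ∀ (h d : E) (t : ℕ → ℝ), (∀ k, 0 < t k) → Tendsto t atTop (𝓝 0) →
      (∀ k, x + t k • h ∈ Ω) →
      Tendsto (fun k => (t k)⁻¹ • (g (x + t k • h) - g x)) atTop (𝓝 d) →
      c * ‖h‖ ^ 2 ≤ inner ℝ d h)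
    {x y : E} (hx : x ∈ Ω) (hy : y ∈ Ω) :
    c * ‖y - x‖ ^ 2 ≤ inner ℝ (g y - g x) (y - x) := by
  set h := y - x with hh
  have hmem : ∀ s ∈ Icc (0 : ℝ) 1, x + s • h ∈ Ω := fun s hs =>
    hΩ.add_smul_sub_mem hx hy hs
  -- The sign is reversed because the comparison principle below bounds a function from above by its
  -- right slopes.
  have hcont : ContinuousOn (fun s : ℝ => -inner ℝ (g (x + s • h)) h) (Icc 0 1) := by
    have h1 : ContinuousOn (fun s : ℝ => g (x + s • h)) (Icc 0 1) :=
      hg.continuousOn.comp (by fun_prop) hmem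
    exact (h1.inner continuousOn_const).neg
  have key := image_le_of_liminf_slope_right_le_deriv_boundary (a := 0) (b := 1) hcont
    (B := fun s => -inner ℝ (g x) h - c * ‖h‖ ^ 2 * s) (B' := fun _ => -(c * ‖h‖ ^ 2))
    (by simp) (by fun_prop)
    (fun s _ => by
      have := (((hasDerivAt_id s).const_mul (c * ‖h‖ ^ 2)).const_sub (-inner ℝ (g x) h))
      simpa using this.hasDerivWithinAt)
    (fun s hs r hr => by
      intro hev
      have hs1 : 0 < 1 - s := sub_pos.2 hs.2
      -- These steps never leave the segment. The Lipschitz bound keeps the quotients `q k` in a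
      -- compact ball, so a subsequence converges and `H` applies to its limit.
      let t : ℕ → ℝ := fun k => (1 - s) / (k + 1)
      have ht0 : ∀ k, 0 < t k := fun k => by positivity
      have ht1 : ∀ k, t k ≤ 1 - s := fun k => div_le_self hs1.le (by simp)
      have htt : Tendsto t atTop (𝓝 0) := by
        have := (tendsto_one_div_add_atTop_nhds_zero_nat (𝕜 := ℝ)).const_mul (1 - s)
        simpa [t, div_eq_mul_inv] using this
      have hxs : x + s • h ∈ Ω := hmem s ⟨hs.1, hs.2.le⟩
      have hadd : ∀ k, x + s • h + t k • h = x + (s + t k) • h := fun k => by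
        rw [add_smul, add_assoc]
      have hin : ∀ k, x + s • h + t k • h ∈ Ω := fun k => by
        rw [hadd]
        exact hmem _ ⟨by linarith [hs.1, ht0 k], by linarith [ht1 k]⟩
      let q : ℕ → E := fun k => (t k)⁻¹ • (g (x + s • h + t k • h) - g (x + s • h))
      have hq : ∀ k, q k ∈ Metric.closedBall (0 : E) (L * ‖h‖) := fun k => by
        have h1 := hg.norm_sub_le (hin k) hxs
        rw [add_sub_cancel_left, norm_smul, Real.norm_of_nonneg (ht0 k).le] at h1
        rw [mem_closedBall_zero_iff, norm_smul, norm_inv, Real.norm_of_nonneg (ht0 k).le,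
          inv_mul_le_iff₀ (ht0 k)]
        linarith
      obtain ⟨d, -, σ, hσ, hd⟩ := tendsto_subseq_of_bounded Metric.isBounded_closedBall hq
      have hcd := H _ hxs h d (t ∘ σ) (fun k => ht0 _) (htt.comp hσ.tendsto_atTop)
        (fun k => hin _) hd
      have hz : Tendsto (fun k => s + t (σ k)) atTop (𝓝[>] s) := by
        refine tendsto_nhdsWithin_iff.2 ⟨?_, Eventually.of_forall fun k => ?_⟩
        · simpa using (htt.comp hσ.tendsto_atTop).const_add s
        · simpa using ht0 (σ k)
      have hev' := hz.eventually hev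
      have hlim : Tendsto (fun k => -inner ℝ ((q ∘ σ) k) h) atTop (𝓝 (-inner ℝ d h)) :=
        (hd.inner tendsto_const_nhds).neg
      have : r ≤ -inner ℝ d h := by
        refine ge_of_tendsto hlim (hev'.mono fun k hk => ?_)
        rw [not_lt, slope_def_field] at hk
        refine hk.trans_eq ?_
        simp only [q, Function.comp, hadd, inner_smul_left, inner_sub_left, add_sub_cancel_left,
          map_inv₀, RCLike.conj_to_real]
        field_simp
        ring
      linarith)
    (right_mem_Icc.2 zero_le_one)
  have hxy : x + (1 : ℝ) • h = y := by simp [hh]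
  rw [hxy] at key
  rw [inner_sub_left]
  linarith

/-- A function with a strongly monotone gradient is strongly convex. -/
theorem sconvex_of_strongly_monotone_gradient [CompleteSpace E] {Ω : Set E} (hΩ : Convex ℝ Ω)
    {e : E → ℝ} {g : E → E} {c : ℝ} (he : ∀ x ∈ Ω, HasGradientAt e (g x) x)
    (hg : ∀ x ∈ Ω, ∀ y ∈ Ω, c * ‖y - x‖ ^ 2 ≤ inner ℝ (g y - g x) (y - x))
    {x y : E} (hx : x ∈ Ω) (hy : y ∈ Ω) {t : ℝ} (ht0 : 0 ≤ t) (ht1 : t ≤ 1) :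
    e ((1 - t) • x + t • y) ≤
      (1 - t) * e x + t * e y - c / 2 * t * (1 - t) * ‖x - y‖ ^ 2 := by
  set h := y - x with hh
  have hmem : ∀ s ∈ Icc (0 : ℝ) 1, x + s • h ∈ Ω := fun s hs =>
    hΩ.add_smul_sub_mem hx hy hs
  -- Subtracting this quadratic turns strong monotonicity of `g` into monotonicity of `θ'`.
  let θ : ℝ → ℝ := fun s => e (x + s • h) - c / 2 * ‖h‖ ^ 2 * s ^ 2
  have hθ : ∀ s ∈ Icc (0 : ℝ) 1,
      HasDerivAt θ (inner ℝ (g (x + s • h)) h - c * ‖h‖ ^ 2 * s) s := fun s hs => by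
    have h1 : HasDerivAt (fun s : ℝ => x + s • h) h s := by
      simpa using ((hasDerivAt_id s).smul_const h).const_add x
    have h2 := (he _ (hmem s hs)).hasFDerivAt.comp_hasDerivAt s h1
    have h3 := ((hasDerivAt_id s).pow 2).const_mul (c / 2 * ‖h‖ ^ 2)
    refine (h2.sub h3).congr_deriv ?_
    simp
    ring
  have hconv : ConvexOn ℝ (Icc 0 1) θ := by
    refine MonotoneOn.convexOn_of_deriv (convex_Icc 0 1)
      (fun s hs => (hθ s hs).continuousAt.continuousWithinAt)
      (fun s hs => (hθ s (interior_subset hs)).differentiableAt.differentiableWithinAt) ?_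
    intro a ha b hb hab
    have ha' := interior_subset ha
    have hb' := interior_subset hb
    rw [(hθ a ha').deriv, (hθ b hb').deriv]
    rcases hab.eq_or_lt with rfl | hlt
    · rfl
    have h1 := hg _ (hmem a ha') _ (hmem b hb')
    have h2 : x + b • h - (x + a • h) = (b - a) • h := by module
    rw [h2, norm_smul, inner_smul_right, inner_sub_left, Real.norm_of_nonneg (sub_nonneg.2 hab),
      mul_pow] at h1
    have hba := sub_pos.2 hlt
    have h3 : (b - a) * (c * ‖h‖ ^ 2 * (b - a)) ≤
        (b - a) * (inner ℝ (g (x + b • h)) h - inner ℝ (g (x + a • h)) h) := by linarith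
    have h4 := le_of_mul_le_mul_left h3 hba
    linarith
  have h5 := hconv.2 (left_mem_Icc.2 zero_le_one) (right_mem_Icc.2 zero_le_one)
    (sub_nonneg.2 ht1) ht0 (by ring)
  have hxy : x + (1 : ℝ) • h = y := by simp [hh]
  have hpt : (1 - t) • x + t • y = x + t • h := by rw [hh]; module
  have hnorm : ‖x - y‖ = ‖h‖ := norm_sub_rev x y
  simp only [smul_eq_mul, mul_zero, mul_one, zero_add, θ, hxy, zero_smul, add_zero] at h5
  rw [hpt, hnorm]
  linarith

end StrongMonotonicity

/-! ### Limiting subgradients of `s`-convex functions. -/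

section Subgradients

variable {n : ℕ} {Ω : Set (EuclideanSpace ℝ (Fin n))} {φ : EuclideanSpace ℝ (Fin n) → EReal}
  {s : ℝ}

theorem IsSConvexOn.le_of_le (hs : IsSConvexOn s Ω φ) {x y : EuclideanSpace ℝ (Fin n)}
    (hx : x ∈ Ω) (hy : y ∈ Ω) {a b t : ℝ} (ha : φ x ≤ a) (hb : φ y ≤ b) (ht0 : 0 < t)
    (ht1 : t < 1) :
    φ ((1 - t) • x + t • y) ≤
      (((1 - t) * a + t * b - s / 2 * t * (1 - t) * ‖x - y‖ ^ 2 : ℝ) : EReal) := by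
  refine (hs x hx y hy t ht0 ht1).trans ?_
  rw [EReal.coe_sub ((1 - t) * a + t * b), EReal.coe_add, EReal.coe_mul, EReal.coe_mul]
  refine EReal.sub_le_sub (add_le_add ?_ ?_) le_rfl
  · exact mul_le_mul_of_nonneg_left ha (by exact_mod_cast (sub_pos.2 ht1).le)
  · exact mul_le_mul_of_nonneg_left hb (by exact_mod_cast ht0.le)

/-- It suffices to check `s`-convexity at points of finiteness. -/
theorem isSConvexOn_of_le (hbot : ∀ x ∈ Ω, φ x ≠ ⊥)
    (h : ∀ x ∈ Ω, ∀ y ∈ Ω, ∀ a b t : ℝ, φ x = a → φ y = b → 0 < t → t < 1 →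
      φ ((1 - t) • x + t • y) ≤
        (((1 - t) * a + t * b - s / 2 * t * (1 - t) * ‖x - y‖ ^ 2 : ℝ) : EReal)) :
    IsSConvexOn s Ω φ := by
  intro x hx y hy t ht0 ht1
  have ht0' : (0 : EReal) < (t : EReal) := by exact_mod_cast ht0
  have ht1' : (0 : EReal) < ((1 - t : ℝ) : EReal) := by exact_mod_cast sub_pos.2 ht1
  have hxb := hbot x hx
  have hyb := hbot y hy
  have H := h x hx y hy
  induction hφx : φ x with
  | bot => exact absurd hφx hxb
  | top =>
    have hne : (t : EReal) * φ y ≠ ⊥ := by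
      induction hφy : φ y with
      | bot => exact absurd hφy hyb
      | top => simp [EReal.mul_top_of_pos ht0']
      | coe b => exact_mod_cast EReal.coe_ne_bot (t * b)
    rw [EReal.mul_top_of_pos ht1', EReal.top_add_of_ne_bot hne, EReal.top_sub_coe]
    exact le_top
  | coe a =>
    induction hφy : φ y with
    | bot => exact absurd hφy hyb
    | top =>
      rw [EReal.mul_top_of_pos ht0', ← EReal.coe_mul, EReal.coe_add_top, EReal.top_sub_coe]
      exact le_top
    | coe b => exact_mod_cast H a b t hφx hφy ht0 ht1

/-- By `s`-convexity the curve `p + t • D t` stays in the epigraph, so a regular normal cannot make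
a positive product with its initial direction `D 0`. -/
theorem inner_add_mul_le_zero_of_mem_regularNormalCone_epi (hΩ : Convex ℝ Ω)
    (hs : IsSConvexOn s Ω φ) {p w : WithLp 2 (EuclideanSpace ℝ (Fin n) × ℝ)}
    (hw : w ∈ regularNormalCone (epi Ω φ) p) {u : EuclideanSpace ℝ (Fin n)} (hu : u ∈ Ω) {γ : ℝ}
    (hγ : φ u ≤ γ) :
    inner ℝ w.fst (u - p.fst) + w.snd * (γ - p.snd - s / 2 * ‖u - p.fst‖ ^ 2) ≤ 0 := by
  obtain ⟨hp, hw⟩ := (mem_regularNormalCone_iff _ _ _).1 hw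
  let D : ℝ → WithLp 2 (EuclideanSpace ℝ (Fin n) × ℝ) := fun t =>
    WithLp.toLp 2 (u - p.fst, γ - p.snd - s / 2 * (1 - t) * ‖u - p.fst‖ ^ 2)
  have hmem : ∀ t : ℝ, 0 < t → t < 1 → p + t • D t ∈ epi Ω φ := by
    intro t ht0 ht1
    have h1 : (p + t • D t).fst = (1 - t) • p.fst + t • u := by
      change p.fst + t • (u - p.fst) = _
      module
    have h2 : (p + t • D t).snd =
        (1 - t) * p.snd + t * γ - s / 2 * t * (1 - t) * ‖p.fst - u‖ ^ 2 := by
      change p.snd + t * (γ - p.snd - s / 2 * (1 - t) * ‖u - p.fst‖ ^ 2) = _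
      rw [norm_sub_rev p.fst u]
      ring
    refine ⟨?_, ?_⟩
    · rw [h1]
      exact hΩ hp.1 hu (sub_pos.2 ht1).le ht0.le (by ring)
    · rw [h1, h2]
      exact hs.le_of_le hp.1 hu hp.2 hγ ht0 ht1
  have hlim : Tendsto (fun t => p + t • D t) (𝓝[>] (0 : ℝ)) (𝓝[epi Ω φ] p) := by
    refine tendsto_nhdsWithin_iff.2 ⟨?_, ?_⟩
    · have h1 : Continuous fun t : ℝ => p + t • D t := by fun_prop
      have h2 := h1.tendsto 0
      simp only [zero_smul, add_zero] at h2
      exact h2.mono_left nhdsWithin_le_nhds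
    · filter_upwards [Ioo_mem_nhdsGT (zero_lt_one' ℝ)] with t ht
      exact hmem t ht.1 ht.2
  have hε : ∀ ε : ℝ, 0 < ε → inner ℝ w (D 0) ≤ ε * ‖D 0‖ := by
    intro ε hε
    have hev : ∀ᶠ t in 𝓝[>] (0 : ℝ), inner ℝ w (D t) ≤ ε * ‖D t‖ := by
      filter_upwards [hlim.eventually (hw ε hε), self_mem_nhdsWithin] with t ht (ht0 : 0 < t)
      rw [add_sub_cancel_left, inner_smul_right, norm_smul, Real.norm_of_nonneg ht0.le] at ht
      refine le_of_mul_le_mul_left (ht.trans_eq ?_) ht0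
      ring
    have hc1 : Continuous fun t => inner ℝ w (D t) := by fun_prop
    have hc2 : Continuous fun t => ε * ‖D t‖ := by fun_prop
    exact le_of_tendsto_of_tendsto ((hc1.tendsto 0).mono_left nhdsWithin_le_nhds)
      ((hc2.tendsto 0).mono_left nhdsWithin_le_nhds) hev
  have h0 : inner ℝ w (D 0) ≤ 0 := by
    have hc : Continuous fun ε : ℝ => ε * ‖D 0‖ := by fun_prop
    have h1 := (hc.tendsto 0).mono_left (nhdsWithin_le_nhds (s := Ioi 0))
    rw [zero_mul] at h1
    exact ge_of_tendsto h1 (by filter_upwards [self_mem_nhdsWithin] with ε h using hε ε h)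
  have h3 : inner ℝ w (D 0) =
      inner ℝ w.fst (u - p.fst) + w.snd * (γ - p.snd - s / 2 * ‖u - p.fst‖ ^ 2) := by
    rw [WithLp.prod_inner_apply]
    simp only [D, sub_zero, mul_one, RCLike.inner_apply, conj_trivial]
    rw [mul_comm w.snd]
    rfl
  rwa [h3] at h0

/-- The subgradient inequality for limiting subgradients of `s`-convex functions. -/
theorem IsSConvexOn.subgradient_le (hs : IsSConvexOn s Ω φ) (hΩ : Convex ℝ Ω)
    {x v u : EuclideanSpace ℝ (Fin n)} (hv : v ∈ limitingSubdifferential Ω φ x) (hu : u ∈ Ω)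
    {γ : ℝ} (hγ : φ u ≤ γ) :
    (φ x).toReal + inner ℝ v (u - x) + s / 2 * ‖u - x‖ ^ 2 ≤ γ := by
  obtain ⟨-, -, -, p, w, -, hp, hw, hN⟩ := hv
  have hlim : Tendsto (fun k => inner ℝ (w k).fst (u - (p k).fst) +
      (w k).snd * (γ - (p k).snd - s / 2 * ‖u - (p k).fst‖ ^ 2)) atTop
      (𝓝 (inner ℝ v (u - x) + (-1) * (γ - (φ x).toReal - s / 2 * ‖u - x‖ ^ 2))) := by
    have hp1 : Tendsto (fun k => (p k).fst) atTop (𝓝 x) :=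
      ((WithLp.continuous_fst 2 _ _).tendsto _).comp hp
    have hp2 : Tendsto (fun k => (p k).snd) atTop (𝓝 (φ x).toReal) :=
      ((WithLp.continuous_snd 2 _ _).tendsto _).comp hp
    have hw1 : Tendsto (fun k => (w k).fst) atTop (𝓝 v) :=
      ((WithLp.continuous_fst 2 _ _).tendsto _).comp hw
    have hw2 : Tendsto (fun k => (w k).snd) atTop (𝓝 (-1)) :=
      ((WithLp.continuous_snd 2 _ _).tendsto _).comp hw
    have hux := hp1.const_sub u
    exact (hw1.inner hux).add (hw2.mul ((hp2.const_sub γ).sub ((hux.norm.pow 2).const_mul _)))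
  have := le_of_tendsto' hlim fun k =>
    inner_add_mul_le_zero_of_mem_regularNormalCone_epi hΩ hs (hN k) hu hγ
  linarith

/-- The subgradient inequality is used at each point, tested at the other; in the sum the values of
`φ` cancel. -/
theorem IsSConvexOn.subdifferential_monotone (hs : IsSConvexOn s Ω φ) (hΩ : Convex ℝ Ω)
    (hbot : ∀ x ∈ Ω, φ x ≠ ⊥) {x y x' y' : EuclideanSpace ℝ (Fin n)}
    (hy : y ∈ limitingSubdifferential Ω φ x) (hy' : y' ∈ limitingSubdifferential Ω φ x') :
    s * ‖x' - x‖ ^ 2 ≤ inner ℝ (y' - y) (x' - x) := by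
  have h1 := hs.subgradient_le hΩ hy hy'.1
    (EReal.coe_toReal hy'.2.1.ne (hbot _ hy'.1)).ge
  have h2 := hs.subgradient_le hΩ hy' hy.1
    (EReal.coe_toReal hy.2.1.ne (hbot _ hy.1)).ge
  rw [norm_sub_rev, ← neg_sub x' x, inner_neg_right] at h2
  rw [inner_sub_left]
  linarith

theorem IsSConvexOn.le_inner_graphicalDerivative (hs : IsSConvexOn s Ω φ) (hΩ : Convex ℝ Ω)
    (hbot : ∀ x ∈ Ω, φ x ≠ ⊥) {x y w z : EuclideanSpace ℝ (Fin n)}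
    (hz : z ∈ subgradientGraphicalDerivative Ω φ x y w) : s * ‖w‖ ^ 2 ≤ inner ℝ z w := by
  obtain ⟨hxy, t, u, ht0, -, hu, hmem⟩ := hz
  have h1 : Tendsto (fun k => (u k).1) atTop (𝓝 w) := (continuous_fst.tendsto _).comp hu
  have h2 : Tendsto (fun k => (u k).2) atTop (𝓝 z) := (continuous_snd.tendsto _).comp hu
  refine le_of_tendsto_of_tendsto' ((h1.norm.pow 2).const_mul s) (h2.inner h1) fun k => ?_
  have h := hs.subdifferential_monotone hΩ hbot (x := x) (y := y) hxy (hmem k)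
  simp only [Prod.fst_add, Prod.snd_add, Prod.smul_fst, Prod.smul_snd, add_sub_cancel_left,
    norm_smul, inner_smul_left, inner_smul_right, Real.norm_of_nonneg (ht0 k).le,
    conj_trivial] at h
  have hpos : 0 < t k * t k := mul_pos (ht0 k) (ht0 k)
  refine le_of_mul_le_mul_left ?_ hpos
  linarith

/-- Regular subgradients are limiting subgradients. -/
theorem mem_limitingSubdifferential_of_eventually {x v : EuclideanSpace ℝ (Fin n)} (hx : x ∈ Ω)
    (hbot : φ x ≠ ⊥) (htop : φ x < ⊤)
    (h : ∀ ε : ℝ, 0 < ε → ∀ᶠ u in 𝓝 x, u ∈ Ω → ∀ a : ℝ, φ u ≤ a →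
      inner ℝ v (u - x) ≤ a - (φ x).toReal + ε * ‖u - x‖) :
    v ∈ limitingSubdifferential Ω φ x := by
  have hmem : WithLp.toLp 2 (x, (φ x).toReal) ∈ epi Ω φ :=
    ⟨hx, (EReal.coe_toReal htop.ne hbot).ge⟩
  refine ⟨hx, htop, hmem, fun _ => _, fun _ => _, fun _ => hmem, tendsto_const_nhds,
    tendsto_const_nhds, fun _ => (mem_regularNormalCone_iff _ _ _).2 ⟨hmem, fun ε hε => ?_⟩⟩
  have hf : Tendsto (fun p : WithLp 2 (EuclideanSpace ℝ (Fin n) × ℝ) => p.fst)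
      (𝓝[epi Ω φ] (WithLp.toLp 2 (x, (φ x).toReal))) (𝓝 x) :=
    ((WithLp.continuous_fst 2 _ _).tendsto _).mono_left nhdsWithin_le_nhds
  filter_upwards [hf.eventually (h ε hε), self_mem_nhdsWithin] with p hp hpe
  have h1 := hp hpe.1 p.snd hpe.2
  have h2 : ‖p.fst - x‖ ≤ ‖p - WithLp.toLp 2 (x, (φ x).toReal)‖ :=
    WithLp.norm_fst_le _ (p - WithLp.toLp 2 (x, (φ x).toReal))
  have h3 : inner ℝ (WithLp.toLp 2 (v, (-1 : ℝ))) (p - WithLp.toLp 2 (x, (φ x).toReal)) =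
      inner ℝ v (p.fst - x) - (p.snd - (φ x).toReal) := by
    rw [WithLp.prod_inner_apply]
    simp only [RCLike.inner_apply, conj_trivial, mul_neg_one]
    rfl
  rw [h3]
  have := mul_le_mul_of_nonneg_left h2 hε.le
  linarith

end Subgradients

/-! ### Proximal points and Moreau envelopes. -/

section Prox

variable {n : ℕ} {φ : EuclideanSpace ℝ (Fin n) → EReal}

/-- `p` is a proximal point of `u`: it minimizes `φ + μ / 2 * ‖· - u‖ ^ 2`, with a finite minimum. -/
def IsProxPoint (φ : EuclideanSpace ℝ (Fin n) → EReal) (μ : ℝ)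
    (u p : EuclideanSpace ℝ (Fin n)) : Prop :=
  φ p ≠ ⊥ ∧ φ p < ⊤ ∧ ∀ (x : EuclideanSpace ℝ (Fin n)) (a : ℝ), φ x ≤ a →
    (φ p).toReal + μ / 2 * ‖p - u‖ ^ 2 ≤ a + μ / 2 * ‖x - u‖ ^ 2

/-- Proximal points of lower semicontinuous weakly convex functions exist. -/
theorem exists_isProxPoint {ρ μ : ℝ} (hρ : IsSConvexOn (-ρ) univ φ) (hμ : ρ < μ) (hμ0 : 0 < μ)
    (hbot : ∀ x, φ x ≠ ⊥) {x₀ : EuclideanSpace ℝ (Fin n)} (hx₀ : φ x₀ < ⊤)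
    (hlsc : LowerSemicontinuous φ) (u : EuclideanSpace ℝ (Fin n)) :
    ∃ p, IsProxPoint φ μ u p := by
  obtain ⟨f₀, hf₀⟩ : ∃ f₀ : ℝ, φ x₀ = f₀ := ⟨_, (EReal.coe_toReal hx₀.ne (hbot _)).symm⟩
  obtain ⟨m, hm⟩ : ∃ m : ℝ, ∀ x ∈ Metric.closedBall x₀ 1, (m : EReal) ≤ φ x := by
    obtain ⟨q, -, hq⟩ := (hlsc.lowerSemicontinuousOn (Metric.closedBall x₀ 1)).exists_isMinOn
      ⟨x₀, by simp⟩ (isCompact_closedBall x₀ 1)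
    obtain ⟨m, -, hm⟩ := EReal.lt_iff_exists_real_btwn.1 (bot_lt_iff_ne_bot.2 (hbot q))
    exact ⟨m, fun x hx => hm.le.trans (hq hx)⟩
  -- Weak convexity is applied at the point of the segment from `x₀` to `x` at distance 1 from `x₀`,
  -- where `φ ≥ m`. So `φ` decreases at most like `ρ / 2 * r ^ 2`, up to linear terms.
  have hgrow : ∀ (x : EuclideanSpace ℝ (Fin n)) (a : ℝ), φ x ≤ a → 1 < ‖x - x₀‖ →
      m * ‖x - x₀‖ - (‖x - x₀‖ - 1) * f₀ - ρ / 2 * ‖x - x₀‖ * (‖x - x₀‖ - 1) ≤ a := by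
    intro x a ha hr
    set r := ‖x - x₀‖ with hr'
    have hr0 : 0 < r := one_pos.trans hr
    have h1 := hρ.le_of_le (mem_univ x₀) (mem_univ x) hf₀.le ha (inv_pos.2 hr0)
      (inv_lt_one_of_one_lt₀ hr)
    have h2 : (1 - r⁻¹) • x₀ + r⁻¹ • x ∈ Metric.closedBall x₀ 1 := by
      have h3 : (1 - r⁻¹) • x₀ + r⁻¹ • x - x₀ = r⁻¹ • (x - x₀) := by module
      rw [mem_closedBall_iff_norm, h3, norm_smul, norm_inv, Real.norm_of_nonneg hr0.le, ← hr',
        inv_mul_cancel₀ hr0.ne']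
    have h4 := EReal.coe_le_coe_iff.1 ((hm _ h2).trans h1)
    rw [norm_sub_rev x₀ x, ← hr'] at h4
    have h5 := mul_le_mul_of_nonneg_left h4 hr0.le
    have h6 : r * ((1 - r⁻¹) * f₀ + r⁻¹ * a - -ρ / 2 * r⁻¹ * (1 - r⁻¹) * r ^ 2) =
        (r - 1) * f₀ + a + ρ / 2 * r * (r - 1) := by
      field_simp
      ring
    rw [h6] at h5
    linarith
  set b := ‖x₀ - u‖ with hb
  set K := |m - f₀ + ρ / 2 - μ * b| with hK
  -- Beyond `R` the growth `(μ - ρ) / 2 * r` dominates the constant bounded by `K`; the summand 1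
  -- puts such points in the range of `hgrow`.
  set R := 1 + 2 * K / (μ - ρ) with hR
  have hμρ : 0 < μ - ρ := sub_pos.2 hμ
  have hR1 : 1 ≤ R := by
    rw [hR]
    have : 0 ≤ 2 * K / (μ - ρ) := by positivity
    linarith
  have hfar : ∀ (x : EuclideanSpace ℝ (Fin n)) (a : ℝ), φ x ≤ a → R < ‖x - x₀‖ →
      f₀ + μ / 2 * b ^ 2 ≤ a + μ / 2 * ‖x - u‖ ^ 2 := by
    intro x a ha hr
    have h1 := hgrow x a ha (hR1.trans_lt hr)
    set r := ‖x - x₀‖ with hr'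
    have hr0 : 0 < r := one_pos.trans (hR1.trans_lt hr)
    have h2 : (r - b) ^ 2 ≤ ‖x - u‖ ^ 2 := by
      refine sq_le_sq' ?_ ?_
      · have := norm_sub_le_norm_sub_add_norm_sub u x x₀
        rw [norm_sub_rev u x₀, norm_sub_rev u x] at this
        linarith
      · have := norm_sub_le_norm_sub_add_norm_sub x u x₀
        rw [norm_sub_rev u x₀] at this
        linarith
    have h3 := mul_le_mul_of_nonneg_left h2 (half_pos hμ0).le
    have h4 : 2 * K < (μ - ρ) * r := by
      have h5 : 2 * K / (μ - ρ) < r := by linarith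
      rwa [div_lt_iff₀' hμρ] at h5
    have h6 : 0 ≤ r * ((m - f₀ + ρ / 2 - μ * b) + (μ - ρ) * r / 2) := by
      have := neg_abs_le (m - f₀ + ρ / 2 - μ * b)
      exact mul_nonneg hr0.le (by linarith)
    linarith
  have hsum : LowerSemicontinuous fun x => φ x + ((μ / 2 * ‖x - u‖ ^ 2 : ℝ) : EReal) := by
    have hc : Continuous fun x : EuclideanSpace ℝ (Fin n) =>
        ((μ / 2 * ‖x - u‖ ^ 2 : ℝ) : EReal) :=
      continuous_coe_real_ereal.comp (by fun_prop)
    exact hlsc.add' hc.lowerSemicontinuous fun x =>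
      EReal.continuousAt_add (Or.inr (EReal.coe_ne_bot _)) (Or.inl (hbot x))
  have hx₀R : x₀ ∈ Metric.closedBall x₀ R := Metric.mem_closedBall_self (zero_le_one.trans hR1)
  obtain ⟨p, -, hp⟩ := (hsum.lowerSemicontinuousOn (Metric.closedBall x₀ R)).exists_isMinOn
    ⟨x₀, hx₀R⟩ (isCompact_closedBall x₀ R)
  have hpx₀ : φ p + ((μ / 2 * ‖p - u‖ ^ 2 : ℝ) : EReal) ≤ ((f₀ + μ / 2 * b ^ 2 : ℝ) : EReal) := by
    have := hp hx₀R
    simpa only [mem_ofPred_eq, hf₀, ← EReal.coe_add] using this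
  have hptop : φ p < ⊤ := by
    rw [lt_top_iff_ne_top]
    intro h
    rw [h, EReal.top_add_coe] at hpx₀
    exact absurd (top_le_iff.1 hpx₀) (EReal.coe_ne_top _)
  refine ⟨p, hbot p, hptop, fun x a ha => ?_⟩
  have hpr : φ p = ((φ p).toReal : EReal) := (EReal.coe_toReal hptop.ne (hbot p)).symm
  by_cases hx : x ∈ Metric.closedBall x₀ R
  · have h1 : φ p + ((μ / 2 * ‖p - u‖ ^ 2 : ℝ) : EReal) ≤
        (a : EReal) + ((μ / 2 * ‖x - u‖ ^ 2 : ℝ) : EReal) :=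
      (hp hx).trans (add_le_add_left ha _)
    rw [hpr] at h1
    exact_mod_cast h1
  · rw [mem_closedBall_iff_norm, not_le] at hx
    rw [hpr] at hpx₀
    have h1 : (φ p).toReal + μ / 2 * ‖p - u‖ ^ 2 ≤ f₀ + μ / 2 * b ^ 2 := by exact_mod_cast hpx₀
    exact h1.trans (hfar x a ha hx)

/-- Expanding the square around `p` leaves an error `μ / 2 * ‖x - p‖ ^ 2`, which is below `ε * ‖x -
p‖` on the ball of radius `ε / μ`. -/
theorem IsProxPoint.smul_sub_mem_subdifferential {μ : ℝ} {u p : EuclideanSpace ℝ (Fin n)}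
    (hμ : 0 < μ) (hp : IsProxPoint φ μ u p) :
    μ • (u - p) ∈ limitingSubdifferential univ φ p := by
  refine mem_limitingSubdifferential_of_eventually (mem_univ p) hp.1 hp.2.1 fun ε hε => ?_
  have hball : Metric.ball p (ε / μ) ∈ 𝓝 p := Metric.ball_mem_nhds _ (by positivity)
  filter_upwards [hball] with x hx _ a ha
  have h1 := hp.2.2 x a ha
  rw [mem_ball_iff_norm, lt_div_iff₀' hμ] at hx
  have h2 : ‖x - u‖ ^ 2 = ‖x - p‖ ^ 2 - 2 * inner ℝ (u - p) (x - p) + ‖p - u‖ ^ 2 := by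
    have : x - u = (x - p) - (u - p) := by abel
    rw [this, norm_sub_sq_real, real_inner_comm, norm_sub_rev p u]
  rw [h2] at h1
  rw [inner_smul_left, conj_trivial]
  have h3 := mul_le_mul_of_nonneg_right hx.le (norm_nonneg (x - p))
  have h4 : 0 ≤ μ * ‖x - p‖ ^ 2 := by positivity
  linarith

/-- The Moreau envelope, in terms of a selection `P` of proximal points. -/
noncomputable def moreauEnvelope (φ : EuclideanSpace ℝ (Fin n) → EReal) (μ : ℝ)
    (P : EuclideanSpace ℝ (Fin n) → EuclideanSpace ℝ (Fin n)) (u : EuclideanSpace ℝ (Fin n)) : ℝ :=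
  (φ (P u)).toReal + μ / 2 * ‖P u - u‖ ^ 2

variable {ρ μ : ℝ} {P : EuclideanSpace ℝ (Fin n) → EuclideanSpace ℝ (Fin n)}

theorem moreauEnvelope_le (hP : ∀ u, IsProxPoint φ μ u (P u)) (u x : EuclideanSpace ℝ (Fin n))
    {a : ℝ} (ha : φ x ≤ a) : moreauEnvelope φ μ P u ≤ a + μ / 2 * ‖x - u‖ ^ 2 :=
  (hP u).2.2 x a ha

/-- `P u` is a competitor in the minimization problem at `u'`. -/
theorem moreauEnvelope_sub_le (hP : ∀ u, IsProxPoint φ μ u (P u))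
    (u u' : EuclideanSpace ℝ (Fin n)) :
    moreauEnvelope φ μ P u' - moreauEnvelope φ μ P u ≤
      inner ℝ (μ • (u - P u)) (u' - u) + μ / 2 * ‖u' - u‖ ^ 2 := by
  have h1 := moreauEnvelope_le hP u' (P u) (EReal.coe_toReal (hP u).2.1.ne (hP u).1).ge
  have h2 : ‖P u - u'‖ ^ 2 = ‖P u - u‖ ^ 2 + 2 * inner ℝ (u - P u) (u' - u) + ‖u' - u‖ ^ 2 := by
    have : P u - u' = -((u - P u) + (u' - u)) := by abel
    rw [this, norm_neg, norm_add_sq_real, norm_sub_rev (P u) u]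
  rw [h2] at h1
  rw [inner_smul_left, conj_trivial]
  unfold moreauEnvelope at h1 ⊢
  linarith

/-- Monotonicity of `∂φ` up to `-ρ`, at the subgradients `μ • (u - P u)`, gives `(μ - ρ) * ‖P u' - P
u‖ ^ 2 ≤ μ * ⟪u' - u, P u' - P u⟫`. -/
theorem norm_prox_sub_le (hρ : IsSConvexOn (-ρ) univ φ) (hμ : ρ < μ) (hμ0 : 0 < μ)
    (hbot : ∀ x, φ x ≠ ⊥) (hP : ∀ u, IsProxPoint φ μ u (P u)) (u u' : EuclideanSpace ℝ (Fin n)) :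
    ‖P u' - P u‖ ≤ μ / (μ - ρ) * ‖u' - u‖ := by
  have h1 := hρ.subdifferential_monotone convex_univ (fun x _ => hbot x)
    ((hP u).smul_sub_mem_subdifferential hμ0) ((hP u').smul_sub_mem_subdifferential hμ0)
  have h2 : μ • (u' - P u') - μ • (u - P u) = μ • ((u' - u) - (P u' - P u)) := by module
  rw [h2, inner_smul_left, conj_trivial, inner_sub_left, real_inner_self_eq_norm_sq] at h1
  have h3 := mul_le_mul_of_nonneg_left (real_inner_le_norm (u' - u) (P u' - P u)) hμ0.le
  have hμρ : 0 < μ - ρ := sub_pos.2 hμ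
  rw [div_mul_eq_mul_div, le_div_iff₀ hμρ]
  rcases (norm_nonneg (P u' - P u)).eq_or_lt with h0 | h0
  · rw [← h0, zero_mul]
    positivity
  · refine le_of_mul_le_mul_left ?_ h0
    linarith

theorem lipschitzWith_smul_sub_prox (hρ : IsSConvexOn (-ρ) univ φ) (hμ : ρ < μ) (hμ0 : 0 < μ)
    (hbot : ∀ x, φ x ≠ ⊥) (hP : ∀ u, IsProxPoint φ μ u (P u)) :
    LipschitzWith (μ * (1 + μ / (μ - ρ))).toNNReal fun u => μ • (u - P u) := by
  refine LipschitzWith.of_dist_le' fun u' u => ?_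
  have h1 : μ • (u' - P u') - μ • (u - P u) = μ • ((u' - u) - (P u' - P u)) := by module
  rw [dist_eq_norm, dist_eq_norm, h1, norm_smul, Real.norm_of_nonneg hμ0.le, mul_assoc]
  refine mul_le_mul_of_nonneg_left ?_ hμ0.le
  have := norm_prox_sub_le hρ hμ hμ0 hbot hP u u'
  have := norm_sub_le (u' - u) (P u' - P u)
  linarith

/-- The remainder is quadratic from both sides: `moreauEnvelope_sub_le` bounds it above, and the
same lemma with `u` and `u'` exchanged, plus the Lipschitz bound on the candidate gradient, bounds
it below. -/
theorem hasGradientAt_moreauEnvelope (hρ : IsSConvexOn (-ρ) univ φ) (hμ : ρ < μ) (hμ0 : 0 < μ)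
    (hbot : ∀ x, φ x ≠ ⊥) (hP : ∀ u, IsProxPoint φ μ u (P u)) (u : EuclideanSpace ℝ (Fin n)) :
    HasGradientAt (moreauEnvelope φ μ P) (μ • (u - P u)) u := by
  set L : NNReal := (μ * (1 + μ / (μ - ρ))).toNNReal
  have hL := lipschitzWith_smul_sub_prox hρ hμ hμ0 hbot hP
  rw [hasGradientAt_iff_isLittleO]
  have hO : (fun u' => moreauEnvelope φ μ P u' - moreauEnvelope φ μ P u -
      inner ℝ (μ • (u - P u)) (u' - u)) =O[𝓝 u] fun u' => ‖u' - u‖ ^ 2 := by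
    refine Asymptotics.IsBigO.of_bound (L + μ / 2) (Eventually.of_forall fun u' => ?_)
    have h1 := moreauEnvelope_sub_le hP u u'
    have h2 := moreauEnvelope_sub_le hP u' u
    rw [norm_sub_rev, ← neg_sub u' u, inner_neg_right] at h2
    have h3 : -(L * ‖u' - u‖ ^ 2) ≤ inner ℝ (μ • (u' - P u') - μ • (u - P u)) (u' - u) := by
      have h4 := neg_le_of_abs_le
        (abs_real_inner_le_norm (μ • (u' - P u') - μ • (u - P u)) (u' - u))
      have h5 := mul_le_mul_of_nonneg_right (hL.norm_sub_le u' u) (norm_nonneg (u' - u))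
      linarith
    rw [inner_sub_left] at h3
    have h6 : 0 ≤ (L : ℝ) * ‖u' - u‖ ^ 2 := by positivity
    rw [Real.norm_eq_abs, norm_pow, norm_norm, abs_le]
    constructor <;> linarith
  refine hO.trans_isLittleO ?_
  have h0 : Tendsto (fun u' => u' - u) (𝓝 u) (𝓝 0) := by
    have : Continuous fun u' : EuclideanSpace ℝ (Fin n) => u' - u := by fun_prop
    simpa using this.tendsto u
  exact (Asymptotics.isLittleO_norm_pow_id (E' := EuclideanSpace ℝ (Fin n)) one_lt_two).comp_tendsto
    h0

/-- A lower bound for the graphical derivative of `∂φ` yields strong convexity of the Moreau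
envelopes of `φ`. -/
theorem moreauEnvelope_sconvex (hρ : IsSConvexOn (-ρ) univ φ) (hμ : ρ < μ) (hμ0 : 0 < μ)
    (hbot : ∀ x, φ x ≠ ⊥) (hP : ∀ u, IsProxPoint φ μ u (P u)) {κ : ℝ} (hκ : 0 < κ)
    (H : ∀ x y w z, z ∈ subgradientGraphicalDerivative univ φ x y w →
      κ * ‖w‖ ^ 2 ≤ inner ℝ z w) (x y : EuclideanSpace ℝ (Fin n)) {t : ℝ} (ht0 : 0 ≤ t)
    (ht1 : t ≤ 1) :
    moreauEnvelope φ μ P ((1 - t) • x + t • y) ≤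
      (1 - t) * moreauEnvelope φ μ P x + t * moreauEnvelope φ μ P y -
        (κ * μ / (μ + κ)) / 2 * t * (1 - t) * ‖x - y‖ ^ 2 := by
  have hsub : ∀ u, μ • (u - P u) ∈ limitingSubdifferential univ φ (P u) := fun u =>
    (hP u).smul_sub_mem_subdifferential hμ0
  refine sconvex_of_strongly_monotone_gradient convex_univ
    (fun u _ => hasGradientAt_moreauEnvelope hρ hμ hμ0 hbot hP u)
    (fun u _ u' _ => strongly_monotone_of_clusterPt_quotient convex_univ
      (lipschitzWith_smul_sub_prox hρ hμ hμ0 hbot hP).lipschitzOnWith ?_ (mem_univ u)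
      (mem_univ u')) (mem_univ x) (mem_univ y) ht0 ht1
  intro u _ h d τ hτ0 hτ _ hd
  -- `D` is the limit of the quotients of `P`, so `(D, d)` is tangent to the graph of `∂φ` at `(P u,
  -- μ • (u - P u))`.
  set D := h - μ⁻¹ • d with hD
  have hdD : d = μ • (h - D) := by
    rw [hD, sub_sub_cancel, smul_inv_smul₀ hμ0.ne']
  have hquot : ∀ k, (τ k)⁻¹ • (P (u + τ k • h) - P u) = h - μ⁻¹ • ((τ k)⁻¹ •
      (μ • (u + τ k • h - P (u + τ k • h)) - μ • (u - P u))) := fun k => by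
    have hτk := (hτ0 k).ne'
    rw [← smul_sub μ, smul_comm (τ k)⁻¹ μ, inv_smul_smul₀ hμ0.ne']
    have : h = (τ k)⁻¹ • τ k • h := (inv_smul_smul₀ hτk h).symm
    nth_rewrite 2 [this]
    rw [← smul_sub]
    congr 1
    abel
  have hder : d ∈ subgradientGraphicalDerivative univ φ (P u) (μ • (u - P u)) D := by
    refine ⟨hsub u, τ, fun k => ((τ k)⁻¹ • (P (u + τ k • h) - P u),
      (τ k)⁻¹ • (μ • (u + τ k • h - P (u + τ k • h)) - μ • (u - P u))), hτ0, hτ, ?_, fun k => ?_⟩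
    · refine Tendsto.prodMk_nhds ?_ hd
      simp only [hquot]
      exact (hd.const_smul _).const_sub h
    · have hτk := (hτ0 k).ne'
      have : (P u, μ • (u - P u)) + τ k • ((τ k)⁻¹ • (P (u + τ k • h) - P u),
          (τ k)⁻¹ • (μ • (u + τ k • h - P (u + τ k • h)) - μ • (u - P u))) =
          (P (u + τ k • h), μ • (u + τ k • h - P (u + τ k • h))) := by
        rw [Prod.smul_mk, smul_inv_smul₀ hτk, smul_inv_smul₀ hτk, Prod.mk_add_mk,
          add_sub_cancel, add_sub_cancel]
      rw [this]
      exact hsub _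
  have h1 := H _ _ _ _ hder
  clear_value D
  subst hdD
  rw [inner_smul_left, conj_trivial, inner_sub_left, real_inner_self_eq_norm_sq] at h1 ⊢
  have hμκ : 0 < μ + κ := add_pos hμ0 hκ
  -- The tangent bound reads `(μ + κ) * ‖D‖ ^ 2 ≤ μ * ⟪D, h⟫`. This square eliminates `‖D‖` and
  -- leaves `(μ + κ) * ⟪D, h⟫ ≤ μ * ‖h‖ ^ 2`.
  have h2 : 0 ≤ ‖(μ + κ) • D - μ • h‖ ^ 2 := sq_nonneg _
  rw [norm_sub_sq_real, norm_smul, norm_smul, inner_smul_left, inner_smul_right, conj_trivial,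
    Real.norm_of_nonneg hμ0.le, Real.norm_of_nonneg hμκ.le] at h2
  rw [real_inner_comm] at h1
  have h3 := mul_le_mul_of_nonneg_left h1 hμκ.le
  have h4 : μ * ((μ + κ) * inner ℝ D h) ≤ μ * (μ * ‖h‖ ^ 2) := by linarith
  have h5 := le_of_mul_le_mul_left h4 hμ0
  rw [div_mul_eq_mul_div, div_le_iff₀ hμκ]
  have h6 := mul_le_mul_of_nonneg_left h5 hμ0.le
  linarith

end Prox

/-! ### Strong convexity in the two cases. -/

section StrongConvexity

variable {n : ℕ} {φ : EuclideanSpace ℝ (Fin n) → EReal} {κ : ℝ}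

theorem isSConvexOn_of_weaklyConvex {ρ : ℝ} (hρ : IsSConvexOn (-ρ) univ φ) (hρ0 : 0 < ρ)
    (hbot : ∀ x, φ x ≠ ⊥) (hlsc : LowerSemicontinuous φ) (hκ : 0 < κ)
    (H : ∀ x y w z, z ∈ subgradientGraphicalDerivative univ φ x y w →
      κ * ‖w‖ ^ 2 ≤ inner ℝ z w) : IsSConvexOn κ univ φ := by
  refine isSConvexOn_of_le (fun x _ => hbot x) fun x _ y _ a b t hxa hyb ht0 ht1 => ?_
  have hxtop : φ x < ⊤ := hxa ▸ EReal.coe_lt_top a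
  let μ : ℕ → ℝ := fun k => ρ + 1 + k
  have hμ : ∀ k, ρ < μ k := fun k => by
    have : (0 : ℝ) ≤ k := k.cast_nonneg
    simp only [μ]
    linarith
  have hμ0 : ∀ k, 0 < μ k := fun k => hρ0.trans (hμ k)
  have hμtop : Tendsto μ atTop atTop := tendsto_atTop_add_const_left _ _ tendsto_natCast_atTop_atTop
  choose P hP using fun k u => exists_isProxPoint hρ (hμ k) (hμ0 k) hbot hxtop hlsc u
  set z := (1 - t) • x + t • y with hz
  let C : ℕ → ℝ := fun k =>
    (1 - t) * a + t * b - κ * μ k / (μ k + κ) / 2 * t * (1 - t) * ‖x - y‖ ^ 2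
  have hval : ∀ k, moreauEnvelope φ (μ k) (P k) z ≤ C k := fun k => by
    have h1 := moreauEnvelope_sconvex hρ (hμ k) (hμ0 k) hbot (hP k) hκ H x y ht0.le ht1.le
    have h2 := moreauEnvelope_le (hP k) x x hxa.le
    have h3 := moreauEnvelope_le (hP k) y y hyb.le
    rw [sub_self, norm_zero] at h2 h3
    have h4 := mul_le_mul_of_nonneg_left h2 (sub_pos.2 ht1).le
    have h5 := mul_le_mul_of_nonneg_left h3 ht0.le
    simp only [C]
    linarith
  have hC : Tendsto C atTop
      (𝓝 ((1 - t) * a + t * b - κ / 2 * t * (1 - t) * ‖x - y‖ ^ 2)) := by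
    have h1 : Tendsto (fun k => κ - κ ^ 2 / (μ k + κ)) atTop (𝓝 (κ - 0)) :=
      ((tendsto_const_nhds.div_atTop (tendsto_atTop_add_const_right _ κ hμtop)).const_sub κ)
    rw [sub_zero] at h1
    have h2 : ∀ k, κ * μ k / (μ k + κ) = κ - κ ^ 2 / (μ k + κ) := fun k => by
      have : μ k + κ ≠ 0 := (add_pos (hμ0 k) hκ).ne'
      field_simp
      ring
    simp only [C, h2]
    exact ((((h1.div_const 2).mul_const t).mul_const (1 - t)).mul_const _).const_sub _
  have hCle : ∀ k, C k ≤ (1 - t) * a + t * b := fun k => by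
    have h1 := hμ0 k
    have h2 := sub_pos.2 ht1
    have : 0 ≤ κ * μ k / (μ k + κ) / 2 * t * (1 - t) * ‖x - y‖ ^ 2 := by positivity
    simp only [C]
    linarith
  have hPz : Tendsto (fun k => P k z) atTop (𝓝 z) := by
    -- `P k z` is a competitor for the envelope with parameter `μ 0`; since `μ k - μ 0 = k`, the
    -- difference of the penalties is `k / 2 * ‖P k z - z‖ ^ 2`.
    have hbd : ∀ k : ℕ, 0 < k → ‖P k z - z‖ ^ 2 ≤
        2 * ((1 - t) * a + t * b - moreauEnvelope φ (μ 0) (P 0) z) / k := fun k hk => by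
      have h1 := (hval k).trans (hCle k)
      have h2 := moreauEnvelope_le (hP 0) z (P k z)
        (EReal.coe_toReal (hP k z).2.1.ne (hP k z).1).ge
      have hk' : (0 : ℝ) < k := by exact_mod_cast hk
      rw [le_div_iff₀ hk']
      have h3 : moreauEnvelope φ (μ k) (P k) z =
        (φ (P k z)).toReal + (ρ + 1 + k) / 2 * ‖P k z - z‖ ^ 2 := rfl
      have h4 : μ 0 = ρ + 1 := by simp [μ]
      rw [h4] at h2 ⊢
      linarith
    have hsq : Tendsto (fun k => ‖P k z - z‖ ^ 2) atTop (𝓝 0) :=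
      squeeze_zero' (Eventually.of_forall fun k => sq_nonneg _)
        ((eventually_gt_atTop 0).mono hbd)
        (tendsto_const_nhds.div_atTop tendsto_natCast_atTop_atTop)
    rw [tendsto_iff_norm_sub_tendsto_zero]
    simpa using hsq.sqrt
  by_contra hlt
  rw [not_le] at hlt
  -- For large `k`, lower semicontinuity gives `φ (P k z) > r`, while the envelope, which dominates
  -- `φ (P k z)`, is at most `C k < r`.
  obtain ⟨r, hr1, hr2⟩ := EReal.lt_iff_exists_real_btwn.1 hlt
  have h1 := hPz.eventually (hlsc z r hr2)
  have h2 := hC.eventually_lt_const (EReal.coe_lt_coe_iff.1 hr1)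
  obtain ⟨k, hk1, hk2⟩ := (h1.and h2).exists
  rw [← EReal.coe_toReal (hP k z).2.1.ne (hP k z).1] at hk1
  replace hk1 := EReal.coe_lt_coe_iff.1 hk1
  have h3 := hval k
  have h4 : 0 ≤ μ k / 2 * ‖P k z - z‖ ^ 2 := by
    have := hμ0 k
    positivity
  unfold moreauEnvelope at h3
  linarith

variable {Ω : Set (EuclideanSpace ℝ (Fin n))}

theorem mem_limitingSubdifferential_of_hasGradientAt {x v : EuclideanSpace ℝ (Fin n)}
    (hx : x ∈ Ω) (hfin : ∀ x ∈ Ω, φ x ≠ ⊥ ∧ φ x ≠ ⊤)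
    (hv : HasGradientAt (fun x => (φ x).toReal) v x) : v ∈ limitingSubdifferential Ω φ x := by
  refine mem_limitingSubdifferential_of_eventually hx (hfin x hx).1
    (lt_top_iff_ne_top.2 (hfin x hx).2) fun ε hε => ?_
  filter_upwards [(hasGradientAt_iff_isLittleO.1 hv).def hε] with u hu huΩ a ha
  have h1 : (φ u).toReal ≤ a := by
    rw [← EReal.coe_toReal (hfin u huΩ).2 (hfin u huΩ).1] at ha
    exact_mod_cast ha
  have h2 := (abs_le.1 hu).1
  linarith

/-- The gradient is a selection of `∂φ`, so each limit `d` of its quotients along `h` lies in the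
graphical derivative at `h`. -/
theorem isSConvexOn_of_lipschitzGradient (hΩo : IsOpen Ω) (hΩc : Convex ℝ Ω)
    (hφ : IsDifferentiableWithLipschitzGradientOn Ω φ)
    (H : ∀ x ∈ Ω, ∀ y w z, z ∈ subgradientGraphicalDerivative Ω φ x y w →
      κ * ‖w‖ ^ 2 ≤ inner ℝ z w) : IsSConvexOn κ Ω φ := by
  obtain ⟨hfin, hdiff, L, hL⟩ := hφ
  have hgrad : ∀ x ∈ Ω, HasGradientAt (fun x => (φ x).toReal)
      (gradient (fun x => (φ x).toReal) x) x := fun x hx =>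
    ((hdiff x hx).differentiableAt (hΩo.mem_nhds hx)).hasGradientAt
  have hsub : ∀ x ∈ Ω, gradient (fun x => (φ x).toReal) x ∈ limitingSubdifferential Ω φ x :=
    fun x hx => mem_limitingSubdifferential_of_hasGradientAt hx hfin (hgrad x hx)
  have hreal : ∀ x ∈ Ω, φ x = ((φ x).toReal : EReal) := fun x hx =>
    (EReal.coe_toReal (hfin x hx).2 (hfin x hx).1).symm
  refine isSConvexOn_of_le (fun x hx => (hfin x hx).1) fun x hx y hy a b t hxa hyb ht0 ht1 => ?_
  have hz : (1 - t) • x + t • y ∈ Ω := hΩc hx hy (sub_pos.2 ht1).le ht0.le (by ring)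
  rw [hreal _ hz, EReal.coe_le_coe_iff]
  have key := sconvex_of_strongly_monotone_gradient (c := κ) hΩc hgrad
    (fun u hu u' hu' => strongly_monotone_of_clusterPt_quotient hΩc hL ?_ hu hu') hx hy ht0.le
    ht1.le
  · simpa only [hxa, hyb, EReal.toReal_coe] using key
  intro u hu h d τ hτ0 hτ hmem hd
  refine H u hu (gradient (fun x => (φ x).toReal) u) h d
    ⟨hsub u hu, τ, _, hτ0, hτ, tendsto_const_nhds.prodMk_nhds hd, fun k => ?_⟩
  rw [Prod.smul_mk, smul_inv_smul₀ (hτ0 k).ne', Prod.mk_add_mk, add_sub_cancel]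
  exact hsub _ (hmem k)

end StrongConvexity

end VarAnalysis

theorem mainTheorem6 (n : ℕ) (Ω : Set (EuclideanSpace ℝ (Fin n)))
    (hΩne : Ω.Nonempty) (hΩo : IsOpen Ω) (hΩc : Convex ℝ Ω)
    (φ : EuclideanSpace ℝ (Fin n) → EReal)
    (hproper : VarAnalysis.IsProper Ω φ) (hlsc : LowerSemicontinuousOn φ Ω)
    (hφ : VarAnalysis.IsDifferentiableWithLipschitzGradientOn Ω φ ∨
      (Ω = Set.univ ∧ VarAnalysis.IsWeaklyConvexOn Ω φ))
    (κ : ℝ) (hκ : 0 < κ) :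
    VarAnalysis.IsStronglyConvexOn κ Ω φ ↔
      ∀ x ∈ Ω, ∀ y : EuclideanSpace ℝ (Fin n),
        (x, y) ∈ VarAnalysis.gph (VarAnalysis.limitingSubdifferential Ω φ) →
        ∀ w : EuclideanSpace ℝ (Fin n),
          ∀ z ∈ VarAnalysis.subgradientGraphicalDerivative Ω φ x y w,
            κ * ‖w‖ ^ 2 ≤ inner ℝ z w := by
  constructor
  · intro h x _ y _ w z hz
    exact h.2.le_inner_graphicalDerivative hΩc hproper.1 hz
  · intro H
    refine ⟨hκ, ?_⟩
    rcases hφ with hφ | ⟨rfl, ρ, hρ0, hρ⟩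
    · exact VarAnalysis.isSConvexOn_of_lipschitzGradient hΩo hΩc hφ
        fun x hx y w z hz => H x hx y hz.1 w z hz
    · exact VarAnalysis.isSConvexOn_of_weaklyConvex hρ hρ0 (fun x => hproper.1 x (mem_univ x))
        (lowerSemicontinuousOn_univ_iff.1 hlsc) hκ
        fun x y w z hz => H x (mem_univ x) y hz.1 w z hz
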